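/- Let $\mathcal X$ be a measurable space, let $n,B\in\mathbb N$ with $B\ge 1$ and $n\ge 2B$, let $g:\mathcal X\to[0,1]$ be measurable, and let $P$ be a probability distribution on $\mathcal X\times[0,1]$ (binary labels in $\{0,1\}$ being a special case). Let $(X,Y)\sim P$ and let $\mathcal D_n=((X_1,Y_1),\dots,(X_n,Y_n))$ consist of $n$ independent draws from $P$. Assume that the law of $g(X)$ is absolutely continuous with respect to Lebesgue measure. UMD (uniform-mass binning without sample splitting) maps $(g,\mathcal D_n)$ to the following predictor $h:\mathcal X\to[0,1]$. Put $S_i=g(X_i)$, let $S_{(1)}\le\dots\le S_{(n)}$ be the order statistics of the $S_i$ (ties broken by index), let $Y_{(1)},\dots,Y_{(n)}$ be the labels in the corresponding order, and put $S_{(0)}=0$, $S_{(n+1)}=1$. For $b=0,\dots,B$ put $A_b=\lceil b(n+1)/B\rceil$. For $b=1,\dots,B$ let $\widehat\Pi_b$ be the mean of $Y_{(A_{b-1}+1)},\dots,Y_{(A_b-1)}$. Then $$h(x)=\sum_{b=1}^{B}\mathbf 1\{S_{(A_{b-1})}\le g(x)<S_{(A_b)}\}\,\widehat\Pi_b .$$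 Let $\alpha\in(0,1)$ and $$\varepsilon=\sqrt{\frac{\log(2B/\alpha)}{2(\lfloor n/B\rfloor-1)}} .$$ Then UMD is $(\varepsilon,\alpha)$-conditionally calibrated (for every such $g$ and $P$): with probability at least $1-\alpha$ over $\mathcal D_n$, $$\bigl|\mathbb E[Y\mid h(X)=r]-r\bigr|\le\varepsilon\quad\text{for all } r\in\mathrm{Range}(h),$$ where $(X,Y)\sim P$ is independent of $\mathcal D_n$, $h$ is held fixed in the conditional expectation, and $r\mapsto\mathbb E[Y\mid h(X)=r]$ denotes a suitable version of the regression function of $Y$ on $h(X)$ (so values $r$ with $\Pr(h(X)=r)=0$, at which it is not determined, impose no condition). Moreover, with probability at least $1-\alpha$ over $\mathcal D_n$, for all $p\in[1,\infty)$ simultaneously, $$\ell_p\text{-ECE}(h):=\Bigl(\mathbb E_X\bigl|\mathbb E[Y\mid h(X)]-h(X)\bigr|^p\Bigr)^{1/p}\le\varepsilon .$$ -/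

import Mathlib

open MeasureTheory ProbabilityTheory

noncomputable section

namespace UMD

/-- The space of predictors: measurable functions `𝒳 → [0, 1]`. -/
abbrev Predictor (𝒳 : Type*) [MeasurableSpace 𝒳] : Type _ :=
  {g : 𝒳 → unitInterval // Measurable g}

/-- A calibrator: it maps a predictor and `n` labelled points to a new predictor. -/
abbrev Calibrator (𝒳 : Type*) [MeasurableSpace 𝒳] (n : ℕ) : Type _ :=
  Predictor 𝒳 → (Fin n → 𝒳 × unitInterval) → Predictor 𝒳

/-- `Q` holds with probability at least `q`: it holds on a measurable event of probability
at least `q`. -/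
def WithProbAtLeast {Ω : Type*} [MeasurableSpace Ω] (μ : Measure Ω) (q : ℝ) (Q : Ω → Prop) :
    Prop :=
  ∃ E : Set Ω, MeasurableSet E ∧ ENNReal.ofReal q ≤ μ E ∧ ∀ ω ∈ E, Q ω

section Calibration

variable {𝒳 : Type*} [MeasurableSpace 𝒳]

/-- The random variable `E[Y | h(X)]` for `(X, Y) ∼ P`. -/
def condLabel (P : Measure (𝒳 × unitInterval)) (h : Predictor 𝒳) : 𝒳 × unitInterval → ℝ :=
  P[fun z => (z.2 : ℝ) | MeasurableSpace.comap (fun z : 𝒳 × unitInterval => h.1 z.1) inferInstance]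

/-- `m` is a version of the regression function `r ↦ E[Y | h(X) = r]`. It is determined up to null
sets of the law of `h(X)`; in particular `m r` is the elementary conditional expectation
whenever `P(h(X) = r) > 0`. -/
def IsRegressionFunction (P : Measure (𝒳 × unitInterval)) (h : Predictor 𝒳)
    (m : unitInterval → ℝ) : Prop :=
  Measurable m ∧ (fun z : 𝒳 × unitInterval => m (h.1 z.1)) =ᵐ[P] condLabel P h

/-- The deterministic property `∀ r ∈ Range(h), |E[Y | h(X) = r] - r| ≤ ε` of a predictor `h`. -/
def IsCalibratedPredictor (P : Measure (𝒳 × unitInterval)) (h : Predictor 𝒳) (ε : ℝ) : Prop :=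
  ∃ m : unitInterval → ℝ, IsRegressionFunction P h m ∧ ∀ r ∈ Set.range h.1, |m r - (r : ℝ)| ≤ ε

/-- The law of the calibration data: `n` independent draws from `P`. -/
def dataLaw (P : Measure (𝒳 × unitInterval)) (n : ℕ) : Measure (Fin n → 𝒳 × unitInterval) :=
  Measure.pi fun _ => P

/-- `(ε, α)`-conditional calibration of `H` for the predictor `g` and the distribution `P`. -/
def ConditionallyCalibratedAt {n : ℕ} (H : Calibrator 𝒳 n) (g : Predictor 𝒳)
    (P : Measure (𝒳 × unitInterval)) (ε α : ℝ) : Prop :=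
  WithProbAtLeast (dataLaw P n) (1 - α) fun D => IsCalibratedPredictor P (H g D) ε

/-- The `ℓ_p` expected calibration error `(E |E[Y | h(X)] - h(X)|^p)^(1/p)`. -/
def ece (P : Measure (𝒳 × unitInterval)) (p : ℝ) (h : Predictor 𝒳) : ENNReal :=
  (∫⁻ z, ENNReal.ofReal (|condLabel P h z - (h.1 z.1 : ℝ)| ^ p) ∂P) ^ (1 / p)

end Calibration

section Algorithm

/-- The array entry `A_b = ⌈b Δ⌉` with `Δ = (n + 1) / B`, for `b = 0, …, B`. -/
def cut (n B b : ℕ) : ℕ := ⌈(b : ℝ) * (((n : ℝ) + 1) / B)⌉₊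

/-- The order statistics `S_(1) ≤ … ≤ S_(n)` of `s`, with `S_(0) = 0` and `S_(n+1) = 1`. Here
`Tuple.sort s` is the permutation that sorts `s`, the ranks being counted from `0`. -/
def orderStat {n : ℕ} (s : Fin n → unitInterval) (i : ℕ) : unitInterval :=
  if i = 0 then 0 else if hi : i - 1 < n then s (Tuple.sort s ⟨i - 1, hi⟩) else 1

/-- The positions strictly between `A_b` and `A_{b+1}`; `i : Fin n` stands for the rank `i + 1`. -/
def innerRanks (n B b : ℕ) : Finset (Fin n) :=
  {i : Fin n | cut n B b < i.1 + 1 ∧ i.1 + 1 < cut n B (b + 1)}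

/-- The bin mean `Mean(Y_(l+1), …, Y_(u-1))` with `l = A_b` and `u = A_{b+1}`; the labels
are ordered as the scores are. -/
def binMean {n : ℕ} (B : ℕ) (s y : Fin n → unitInterval) (b : ℕ) : ℝ :=
  (∑ i ∈ innerRanks n B b, (y (Tuple.sort s i) : ℝ)) / (innerRanks n B b).card

/-- The value of the recalibrated predictor at a point with score `t`:
`∑_b 1{S_(A_b) ≤ t < S_(A_{b+1})} · (mean of bin b)`, with bins `b = 0, …, B - 1`. -/
def binnedValue {n : ℕ} (B : ℕ) (s y : Fin n → unitInterval) (t : unitInterval) : ℝ :=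
  ∑ b ∈ Finset.range B,
    if orderStat s (cut n B b) ≤ t ∧ t < orderStat s (cut n B (b + 1)) then binMean B s y b else 0

theorem cut_mono (n B : ℕ) : Monotone (cut n B) := by
  intro a b hab
  unfold cut
  gcongr

theorem orderStat_mono {n : ℕ} (s : Fin n → unitInterval) : Monotone (orderStat s) := by
  intro i j hij
  unfold orderStat
  by_cases hi : i = 0
  · simp [hi]
  have hj : j ≠ 0 := by omega
  simp only [hi, hj, if_false]
  by_cases hjn : j - 1 < n
  · have hin : i - 1 < n := by omega
    simp only [hin, hjn, dif_pos]
    exact Tuple.monotone_sort s (by simp only [Fin.mk_le_mk]; omega)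
  · simp only [hjn, dif_neg, not_false_eq_true]
    exact le_top

theorem binMean_mem {n : ℕ} (B : ℕ) (s y : Fin n → unitInterval) (b : ℕ) :
    binMean B s y b ∈ Set.Icc (0 : ℝ) 1 := by
  unfold binMean
  refine ⟨div_nonneg (Finset.sum_nonneg fun i _ => (y _).2.1) (Nat.cast_nonneg _),
    div_le_one_of_le₀ ?_ (Nat.cast_nonneg _)⟩
  calc _ ≤ ∑ _i ∈ innerRanks n B b, (1 : ℝ) := Finset.sum_le_sum fun i _ => (y _).2.2
    _ = _ := by simp

theorem binnedValue_mem {n : ℕ} (B : ℕ) (s y : Fin n → unitInterval) (t : unitInterval) :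
    binnedValue B s y t ∈ Set.Icc (0 : ℝ) 1 := by
  unfold binnedValue
  by_cases h : ∃ b ∈ Finset.range B,
      orderStat s (cut n B b) ≤ t ∧ t < orderStat s (cut n B (b + 1))
  · obtain ⟨b, hb, h1, h2⟩ := h
    rw [Finset.sum_eq_single_of_mem b hb, if_pos ⟨h1, h2⟩]
    · exact binMean_mem B s y b
    · intro c _ hcb
      refine if_neg ?_
      rintro ⟨h3, h4⟩
      rcases lt_or_gt_of_ne hcb with hlt | hlt
      · exact absurd (h4.trans_le ((orderStat_mono s (cut_mono n B hlt)).trans h1)) (lt_irrefl _)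
      · exact absurd (h2.trans_le ((orderStat_mono s (cut_mono n B hlt)).trans h3)) (lt_irrefl _)
  · rw [Finset.sum_eq_zero]
    · simp
    · exact fun b hb => if_neg fun hc => h ⟨b, hb, hc⟩

theorem measurable_binnedValue {n : ℕ} (B : ℕ) (s y : Fin n → unitInterval) :
    Measurable (binnedValue B s y) := by
  unfold binnedValue
  refine Finset.measurable_sum _ fun b _ => Measurable.ite ?_ measurable_const measurable_const
  exact measurableSet_Ico

/-- Uniform-mass binning without sample splitting, with `B` bins. -/
def umd {𝒳 : Type*} [MeasurableSpace 𝒳] (n B : ℕ) : Calibrator 𝒳 n := fun g D =>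
  ⟨fun x => ⟨binnedValue B (fun i => g.1 (D i).1) (fun i => (D i).2) (g.1 x),
    binnedValue_mem B _ _ _⟩,
    ((measurable_binnedValue B _ _).comp g.2).subtype_mk⟩

end Algorithm

end UMD

end

/-!
Fix the set `T` of indices of the scores strictly between two order statistics `S_(l)` and `S_(u)`,
and fix the points outside `T`. These points alone determine `S_(l)` and `S_(u)`, so the points in
`T` are independent draws from `P` conditioned on the bin, and Hoeffding's inequality applies to
their mean label although the same data also chose the bin. A bin has at least `⌊n/B⌋ - 1` inner
points, since almost surely there are no ties, and a union bound over the `B` bins controls all bin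
means at once. As `h` is constant on each bin, every level set of `h` is a union of bins, so the
bounds for the bins add up to the bound `|E[Y | h(X)] - h(X)| ≤ ε` almost surely.
-/

namespace UMD

section OrderStatistics

variable {n l u : ℕ} {T : Finset (Fin n)} {s s' : Fin n → unitInterval}

@[simp]
theorem orderStat_zero (s : Fin n → unitInterval) : orderStat s 0 = 0 := by
  simp only [orderStat, if_true]

@[simp]
theorem orderStat_succ (s : Fin n → unitInterval) (i : Fin n) :
    orderStat s (i + 1) = s (Tuple.sort s i) := by
  simp [orderStat]

theorem orderStat_of_lt (s : Fin n → unitInterval) {i : ℕ} (hi : n < i) : orderStat s i = 1 := by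
  rw [orderStat, if_neg (by omega), dif_neg (by omega)]

theorem orderStat_mem_iff_of_isLowerSet {A : Set unitInterval} (hA : IsLowerSet A)
    [DecidablePred (· ∈ A)] {i : ℕ} (hi : 1 ≤ i) (hin : i ≤ n) :
    orderStat s i ∈ A ↔ i ≤ Finset.card {k | s k ∈ A} := by
  have hrank : ∀ j : ℕ, ((Finset.univ.filter fun k : Fin n => k.1 < j).map
      (Tuple.sort s).toEmbedding).card = min n j := fun j => by
    rw [Finset.card_map, Fin.card_filter_val_lt]
  constructor
  · intro hmem
    rw [← min_eq_right hin, ← hrank i]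
    refine Finset.card_le_card fun k hk => ?_
    obtain ⟨j, hj, rfl⟩ := Finset.mem_map.1 hk
    rw [Finset.mem_filter_univ] at hj ⊢
    exact hA ((orderStat_succ s j).symm.trans_le (orderStat_mono s hj)) hmem
  · intro hcard
    by_contra hmem
    have hsub : Finset.card {k | s k ∈ A} ≤ min n (i - 1) := by
      rw [← hrank (i - 1)]
      refine Finset.card_le_card fun k hk => Finset.mem_map.2 ⟨(Tuple.sort s).symm k, ?_, by simp⟩
      rw [Finset.mem_filter_univ] at hk ⊢
      by_contra hge
      have hle := orderStat_mono s (show i ≤ ((Tuple.sort s).symm k).1 + 1 by omega)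
      rw [orderStat_succ, Equiv.apply_symm_apply] at hle
      exact hmem (hA hle hk)
    omega

theorem orderStat_mem_of_forall_imp {A : Set unitInterval} (hA : IsLowerSet A)
    (h : ∀ k, s k ∈ A → s' k ∈ A) {i : ℕ} (hi : 1 ≤ i) (hin : i ≤ n) (hs : orderStat s i ∈ A) :
    orderStat s' i ∈ A := by
  classical
  rw [orderStat_mem_iff_of_isLowerSet hA hi hin] at hs ⊢
  exact hs.trans (Finset.card_le_card (Finset.monotone_filter_right _ fun k _ => h k))

theorem measurable_orderStat (i : ℕ) :
    Measurable fun s : Fin n → unitInterval => orderStat s i := by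
  rcases Nat.eq_zero_or_pos i with rfl | hi
  · simp only [orderStat_zero, measurable_const]
  rcases lt_or_ge n i with hin | hin
  · simp only [orderStat_of_lt _ hin, measurable_const]
  refine measurable_of_Iic fun t => ?_
  have hpre : (fun s : Fin n → unitInterval => orderStat s i) ⁻¹' Set.Iic t =
      {s | i ≤ ∑ k, if s k ∈ Set.Iic t then 1 else 0} := by
    ext s
    rw [Set.mem_preimage, orderStat_mem_iff_of_isLowerSet (isLowerSet_Iic t) hi hin,
      Finset.card_filter, Set.mem_ofPred_eq]
  rw [hpre]
  refine measurableSet_le measurable_const (Finset.measurable_sum _ fun k _ => ?_)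
  exact Measurable.ite (measurableSet_Iic.preimage (measurable_pi_apply k))
    measurable_const measurable_const

theorem strictMonoOn_orderStat (hinj : Function.Injective s) (h0 : ∀ k, s k ≠ 0)
    (h1 : ∀ k, s k ≠ 1) : StrictMonoOn (orderStat s) (Set.Iic (n + 1)) := by
  refine strictMonoOn_Iic_of_lt_succ fun i hi => ?_
  refine lt_of_le_of_ne (orderStat_mono s (Order.le_succ i)) ?_
  rw [Order.succ_eq_add_one]
  rcases i with - | i
  · rcases n with - | n
    · simp [orderStat_of_lt s zero_lt_one]
    · exact fun h => h0 _ ((orderStat_succ s 0).symm.trans (h.symm.trans (orderStat_zero s)))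
  have hrank : orderStat s (i + 1) = _ := orderStat_succ s ⟨i, by omega⟩
  rcases Nat.lt_or_ge n (i + 1 + 1) with hlast | hlast
  · rw [orderStat_of_lt s hlast, hrank]
    exact h1 _
  · have hrank' : orderStat s (i + 1 + 1) = _ := orderStat_succ s ⟨i + 1, hlast⟩
    rw [hrank, hrank', Ne, hinj.eq_iff, (Tuple.sort s).injective.eq_iff, Fin.mk.injEq]
    exact i.lt_succ_self.ne

/-- The indices of the values of `s` strictly between the order statistics of ranks `l` and `u`. -/
noncomputable def innerIndices (l u : ℕ) (s : Fin n → unitInterval) : Finset (Fin n) :=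
  {k | s k ∈ Set.Ioo (orderStat s l) (orderStat s u)}

@[simp]
theorem mem_innerIndices {k : Fin n} :
    k ∈ innerIndices l u s ↔ s k ∈ Set.Ioo (orderStat s l) (orderStat s u) :=
  Finset.mem_filter_univ k

/-- The ranks strictly between `l` and `u`; as in `innerRanks`, `i : Fin n` stands for the rank
`i + 1`. -/
def ranksBetween (n l u : ℕ) : Finset (Fin n) :=
  {i | l < i.1 + 1 ∧ i.1 + 1 < u}

theorem card_ranksBetween (hu : u ≤ n + 1) : (ranksBetween n l u).card = u - l - 1 := by
  have hval : (ranksBetween n l u).map Fin.valEmbedding = Finset.Ico l (u - 1) := by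
    ext i
    simp only [ranksBetween, Finset.mem_map, Finset.mem_filter_univ, Fin.valEmbedding_apply,
      Finset.mem_Ico]
    exact ⟨by rintro ⟨j, hj, rfl⟩; omega, fun hi => ⟨⟨i, by omega⟩, by simp only; omega, rfl⟩⟩
  rw [← Finset.card_map Fin.valEmbedding, hval, Nat.card_Ico]
  omega

theorem innerIndices_eq_map_sort (hinj : Function.Injective s) (h0 : ∀ k, s k ≠ 0)
    (h1 : ∀ k, s k ≠ 1) (hl : l ≤ n + 1) (hu : u ≤ n + 1) :
    innerIndices l u s = (ranksBetween n l u).map (Tuple.sort s).toEmbedding := by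
  have hmono := strictMonoOn_orderStat hinj h0 h1
  ext k
  obtain ⟨i, rfl⟩ := (Tuple.sort s).surjective k
  have hi : (i : ℕ) + 1 ∈ Set.Iic (n + 1) := by simp [i.2.le]
  rw [mem_innerIndices, Set.mem_Ioo, ← orderStat_succ s i, hmono.lt_iff_lt hl hi,
    hmono.lt_iff_lt hi hu, ← Equiv.coe_toEmbedding, Finset.mem_map', ranksBetween,
    Finset.mem_filter_univ]

theorem orderStat_le_of_eqOn_compl_innerIndices (hT : T ⊆ innerIndices l u s)
    (h : ∀ k ∉ T, s' k = s k) (hl : l ≤ n) : orderStat s' l ≤ orderStat s l := by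
  rcases Nat.eq_zero_or_pos l with rfl | hl0
  · simp only [orderStat_zero, le_refl]
  refine orderStat_mem_of_forall_imp (isLowerSet_Iic _) (fun k hk => ?_) hl0 hl Set.self_mem_Iic
  rwa [h k fun hkT => (mem_innerIndices.1 (hT hkT)).1.not_ge hk]

theorem le_orderStat_of_eqOn_compl_innerIndices (hT : T ⊆ innerIndices l u s)
    (h : ∀ k ∉ T, s' k = s k) (hu : 1 ≤ u) : orderStat s u ≤ orderStat s' u := by
  rcases lt_or_ge n u with hun | hun
  · rw [orderStat_of_lt s hun, orderStat_of_lt s' hun]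
  by_contra! hlt
  refine lt_irrefl (orderStat s u)
    (orderStat_mem_of_forall_imp (isLowerSet_Iio _) (fun k hk => ?_) hu hun hlt)
  by_cases hkT : k ∈ T
  · exact (mem_innerIndices.1 (hT hkT)).2
  · rwa [h k hkT] at hk

theorem orderStat_eq_of_eqOn_compl_innerIndices (h : ∀ k ∉ innerIndices l u s, s' k = s k)
    (hs' : innerIndices l u s ⊆ innerIndices l u s') (hl : l ≤ n) (hu : 1 ≤ u) :
    orderStat s' l = orderStat s l ∧ orderStat s' u = orderStat s u := by
  have h' : ∀ k ∉ innerIndices l u s, s k = s' k := fun k hk => (h k hk).symm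
  exact ⟨(orderStat_le_of_eqOn_compl_innerIndices subset_rfl h hl).antisymm
      (orderStat_le_of_eqOn_compl_innerIndices hs' h' hl),
    (le_orderStat_of_eqOn_compl_innerIndices hs' h' hu).antisymm
      (le_orderStat_of_eqOn_compl_innerIndices subset_rfl h hu)⟩

theorem innerIndices_eq_iff_of_eqOn_compl (h : ∀ k ∉ innerIndices l u s, s' k = s k)
    (hl : l ≤ n) (hu : 1 ≤ u) :
    innerIndices l u s' = innerIndices l u s ↔
      ∀ k ∈ innerIndices l u s, s' k ∈ Set.Ioo (orderStat s l) (orderStat s u) := by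
  constructor
  · intro heq k hk
    obtain ⟨hl', hu'⟩ := orderStat_eq_of_eqOn_compl_innerIndices h heq.ge hl hu
    rw [← hl', ← hu']
    exact mem_innerIndices.1 (heq.ge hk)
  · intro hmem
    have hsub : innerIndices l u s ⊆ innerIndices l u s' := fun k hk => mem_innerIndices.2
      ⟨(orderStat_le_of_eqOn_compl_innerIndices subset_rfl h hl).trans_lt (hmem k hk).1,
        (hmem k hk).2.trans_le (le_orderStat_of_eqOn_compl_innerIndices subset_rfl h hu)⟩
    obtain ⟨hl', hu'⟩ := orderStat_eq_of_eqOn_compl_innerIndices h hsub hl hu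
    refine Finset.Subset.antisymm (fun k hk => ?_) hsub
    by_contra hks
    rw [mem_innerIndices, hl', hu', h k hks] at hk
    exact hks (mem_innerIndices.2 hk)

end OrderStatistics

section Conditioning

variable {ι : Type*} [Fintype ι] {Z : ι → Type*} [∀ i, MeasurableSpace (Z i)]

theorem cond_pi (μ : ∀ i, Measure (Z i)) [∀ i, IsFiniteMeasure (μ i)] {A : ∀ i, Set (Z i)}
    (hA : ∀ i, MeasurableSet (A i)) :
    (Measure.pi μ)[|Set.univ.pi A] = Measure.pi fun i => (μ i)[|A i] := by
  refine (Measure.pi_eq fun t _ => ?_).symm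
  rw [cond_apply (MeasurableSet.univ_pi hA), ← Set.pi_inter_distrib, Measure.pi_pi, Measure.pi_pi,
    mul_comm, ← div_eq_mul_inv, ← ENNReal.prod_div_distrib_of_ne_top fun i _ => measure_ne_top _ _]
  exact Finset.prod_congr rfl fun i _ => by rw [cond_apply (hA i), mul_comm, div_eq_mul_inv]

end Conditioning

section ApproxMean

variable {Z : Type*} [MeasurableSpace Z] {μ : Measure Z} {f : Z → ℝ} {ε m : ℝ} {A : Set Z}

/-- `m` is within `ε` of the mean of `f` over `A`. The inequality is multiplied by the mass of `A`,
so that null sets, over which the mean is not defined, impose no condition. -/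
def IsApproxMean (μ : Measure Z) (f : Z → ℝ) (ε : ℝ) (A : Set Z) (m : ℝ) : Prop :=
  |∫ z in A, (f z - m) ∂μ| ≤ ε * μ.real A

theorem isApproxMean_of_measure_eq_zero (hA : μ A = 0) : IsApproxMean μ f ε A m := by
  rw [IsApproxMean, setIntegral_measure_zero _ hA, measureReal_def, hA, abs_zero,
    ENNReal.toReal_zero, mul_zero]

theorem isApproxMean_congr_set {A' : Set Z} (hA : A =ᵐ[μ] A') :
    IsApproxMean μ f ε A m ↔ IsApproxMean μ f ε A' m := by
  rw [IsApproxMean, IsApproxMean, setIntegral_congr_set hA, measureReal_congr hA]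

theorem isApproxMean_of_abs_sub_integral_cond_le [IsFiniteMeasure μ] (hf : IntegrableOn f A μ)
    (h : |m - ∫ z, f z ∂μ[|A]| ≤ ε) : IsApproxMean μ f ε A m := by
  have hmean : ∫ z in A, f z ∂μ = μ.real A * ∫ z, f z ∂μ[|A] := by
    rw [← measure_smul_setAverage f (measure_ne_top μ A), setAverage_eq', smul_eq_mul,
      ProbabilityTheory.cond]
  rw [IsApproxMean, integral_sub hf (integrable_const m), setIntegral_const, hmean, smul_eq_mul,
    ← mul_sub, abs_mul, abs_of_nonneg measureReal_nonneg, abs_sub_comm, mul_comm ε]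
  exact mul_le_mul_of_nonneg_left h measureReal_nonneg

theorem measurableSet_isApproxMean {Ω : Type*} [MeasurableSpace Ω] [SFinite μ] (hf : Measurable f)
    {S : Set (Ω × Z)} (hS : MeasurableSet S) {m : Ω → ℝ} (hm : Measurable m) :
    MeasurableSet {ω | IsApproxMean μ f ε (Prod.mk ω ⁻¹' S) (m ω)} := by
  have hmass : Measurable fun ω => μ.real (Prod.mk ω ⁻¹' S) :=
    (measurable_measure_prodMk_left hS).ennreal_toReal
  have hint : Measurable fun ω => ∫ z in Prod.mk ω ⁻¹' S, (f z - m ω) ∂μ := by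
    have hind : Measurable (S.indicator fun p => f p.2 - m p.1) :=
      ((hf.comp measurable_snd).sub (hm.comp measurable_fst)).indicator hS
    simp_rw [← integral_indicator (measurable_prodMk_left hS)]
    exact (hind.stronglyMeasurable.integral_prod_right' (ν := μ)).measurable
  exact measurableSet_le hint.abs (measurable_const.mul hmass)

end ApproxMean

section Hoeffding

theorem measureReal_le_abs_of_hasSubgaussianMGF {Ω : Type*} [MeasurableSpace Ω] {μ : Measure Ω}
    [IsFiniteMeasure μ] {X : Ω → ℝ} {c : NNReal} (h : HasSubgaussianMGF X c μ) {ε : ℝ}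
    (hε : 0 ≤ ε) : μ.real {ω | ε ≤ |X ω|} ≤ 2 * Real.exp (-ε ^ 2 / (2 * c)) := by
  have hset : {ω | ε ≤ |X ω|} = {ω | ε ≤ X ω} ∪ {ω | ε ≤ (-X) ω} := by
    ext ω
    simp only [Set.mem_union, Set.mem_ofPred_eq, Pi.neg_apply, le_abs]
  rw [hset, two_mul]
  exact (measureReal_union_le _ _).trans (add_le_add (h.measure_ge_le hε) (h.neg.measure_ge_le hε))

variable {Z : Type*} [MeasurableSpace Z] {ι : Type*} [Fintype ι] {f : Z → ℝ}

theorem hasSubgaussianMGF_sum_sub_integral (Q : Measure Z) [IsProbabilityMeasure Q] {a b : ℝ}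
    (hf : Measurable f) (hab : ∀ z, f z ∈ Set.Icc a b) :
    HasSubgaussianMGF (fun v : ι → Z => ∑ i, (f (v i) - ∫ z, f z ∂Q))
      (Fintype.card ι * (‖b - a‖₊ / 2) ^ 2) (Measure.pi fun _ => Q) := by
  have hsub := hasSubgaussianMGF_of_mem_Icc (μ := Q) hf.aemeasurable (ae_of_all _ hab)
  have hind : iIndepFun (fun (i : ι) (v : ι → Z) => f (v i) - ∫ z, f z ∂Q)
      (Measure.pi fun _ => Q) :=
    iIndepFun_pi (X := fun _ z => f z - ∫ z, f z ∂Q) fun _ => (hf.sub_const _).aemeasurable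
  have hsum := HasSubgaussianMGF.sum_of_iIndepFun hind (s := Finset.univ)
    (c := fun _ => (‖b - a‖₊ / 2) ^ 2) fun i _ => by
      have heval := measurePreserving_eval (fun _ : ι => Q) i
      exact HasSubgaussianMGF.of_map (X := fun z => f z - ∫ z, f z ∂Q) heval.aemeasurable
        (heval.map_eq.symm ▸ hsub)
  rwa [Finset.sum_const, Finset.card_univ, nsmul_eq_mul] at hsum

theorem measure_pi_lt_abs_mean_sub_integral_le (Q : Measure Z) [IsProbabilityMeasure Q]
    (hf : Measurable f) (h01 : ∀ z, f z ∈ Set.Icc (0 : ℝ) 1) {ε : ℝ} (hε : 0 ≤ ε) :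
    Measure.pi (fun _ : ι => Q)
        {v | ε < |(∑ i, f (v i)) / Fintype.card ι - ∫ z, f z ∂Q|} ≤
      ENNReal.ofReal (2 * Real.exp (-2 * Fintype.card ι * ε ^ 2)) := by
  rcases isEmpty_or_nonempty ι with hι | hι
  · exact prob_le_one.trans (by simp)
  have hN : (0 : ℝ) < Fintype.card ι := Nat.cast_pos.2 Fintype.card_pos
  have htail := measureReal_le_abs_of_hasSubgaussianMGF
    (hasSubgaussianMGF_sum_sub_integral (ι := ι) Q hf h01) (mul_nonneg hN.le hε)
  have hexp : -(Fintype.card ι * ε) ^ 2 /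
      (2 * ((Fintype.card ι * (‖(1 : ℝ) - 0‖₊ / 2) ^ 2 : NNReal) : ℝ)) =
      -2 * Fintype.card ι * ε ^ 2 := by
    simp only [sub_zero, nnnorm_one]
    push_cast
    field
  rw [hexp] at htail
  refine (measure_mono fun v hv => ?_).trans
    ((ENNReal.le_ofReal_iff_toReal_le (measure_ne_top _ _) (by positivity)).2 htail)
  rw [Set.mem_ofPred_eq] at hv ⊢
  have hmean : (∑ i, f (v i)) / Fintype.card ι - ∫ z, f z ∂Q =
      (∑ i, (f (v i) - ∫ z, f z ∂Q)) / Fintype.card ι := by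
    rw [Finset.sum_sub_distrib, Finset.sum_const, Finset.card_univ, nsmul_eq_mul]
    field
  rw [hmean, abs_div, abs_of_pos hN, lt_div_iff₀' hN] at hv
  exact hv.le

theorem measure_pi_forall_mem_and_not_isApproxMean_le (P : Measure Z) [IsFiniteMeasure P]
    (hf : Measurable f) (h01 : ∀ z, f z ∈ Set.Icc (0 : ℝ) 1) {A : Set Z} (hA : MeasurableSet A)
    {ε : ℝ} (hε : 0 ≤ ε) :
    Measure.pi (fun _ : ι => P)
        {v | (∀ i, v i ∈ A) ∧ ¬IsApproxMean P f ε A ((∑ i, f (v i)) / Fintype.card ι)} ≤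
      ENNReal.ofReal (2 * Real.exp (-2 * Fintype.card ι * ε ^ 2)) *
        Measure.pi (fun _ : ι => P) {v | ∀ i, v i ∈ A} := by
  rcases eq_or_ne (P A) 0 with h0 | h0
  · simp [isApproxMean_of_measure_eq_zero h0]
  have := cond_isProbabilityMeasure h0
  have hint : IntegrableOn f A P :=
    Integrable.of_mem_Icc 0 1 hf.aemeasurable (ae_of_all _ h01)
  have hbox : {v : ι → Z | ∀ i, v i ∈ A} = Set.univ.pi fun _ => A := by
    ext v
    exact Set.mem_univ_pi.symm
  rw [Set.ofPred_and, hbox, ← cond_mul_eq_inter (MeasurableSet.univ_pi fun _ => hA),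
    cond_pi _ fun _ => hA]
  gcongr
  refine (measure_mono fun v hv => ?_).trans
    (measure_pi_lt_abs_mean_sub_integral_le (ι := ι) P[|A] hf h01 hε)
  by_contra hle
  exact hv (isApproxMean_of_abs_sub_integral_cond_le hint (not_lt.1 hle))

end Hoeffding

section Resampling

theorem measure_pi_le_mul_of_forall_updateFinset {ι : Type*} [Fintype ι] [DecidableEq ι]
    {Z : ι → Type*} [∀ i, MeasurableSpace (Z i)] (μ : ∀ i, Measure (Z i)) [∀ i, SigmaFinite (μ i)]
    (T : Finset ι) {F G : Set (∀ i, Z i)} (hF : MeasurableSet F) (hG : MeasurableSet G)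
    (hGF : G ⊆ F) {c : ENNReal}
    (h : ∀ x ∈ F, Measure.pi (fun i : T => μ i) {v | Function.updateFinset x T v ∈ G} ≤
      c * Measure.pi (fun i : T => μ i) {v | Function.updateFinset x T v ∈ F}) :
    Measure.pi μ G ≤ c * Measure.pi μ F := by
  rw [← lintegral_indicator_one hG, ← lintegral_indicator_one hF,
    ← lintegral_const_mul _ (measurable_one.indicator hF)]
  have hG' : Measurable (G.indicator (1 : (∀ i, Z i) → ENNReal)) := measurable_one.indicator hG
  have hF' : Measurable (F.indicator (1 : (∀ i, Z i) → ENNReal)) := measurable_one.indicator hF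
  refine lintegral_le_of_lmarginal_le T hG' (hF'.const_mul c) fun x => ?_
  have hslice {S : Set (∀ i, Z i)} (hS : MeasurableSet S) :
      ∫⁻ v, S.indicator 1 (Function.updateFinset x T v) ∂Measure.pi (fun i : T => μ i) =
        Measure.pi (fun i : T => μ i) {v | Function.updateFinset x T v ∈ S} :=
    lintegral_indicator_one (measurable_updateFinset hS)
  have hFx : Measurable fun v => F.indicator (1 : (∀ i, Z i) → ENNReal)
      (Function.updateFinset x T v) := hF'.comp measurable_updateFinset
  rw [lmarginal, lmarginal, hslice hG, lintegral_const_mul c hFx, hslice hF]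
  by_cases hne : ∃ v₀, Function.updateFinset x T v₀ ∈ F
  · obtain ⟨v₀, hv₀⟩ := hne
    simpa only [Function.updateFinset_updateFinset_of_subset subset_rfl] using h _ hv₀
  · have hempty : {v | Function.updateFinset x T v ∈ G} = ∅ :=
      Set.eq_empty_of_forall_notMem fun v hv => hne ⟨v, hGF hv⟩
    rw [hempty, measure_empty]
    exact zero_le

variable {Z : Type*} [MeasurableSpace Z] {φ : Z → unitInterval} {f : Z → ℝ} {n l u : ℕ} {ε : ℝ}

/-- The points whose score `φ` lies strictly between the scores of ranks `l` and `u` of the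
sample `D`. -/
def band (φ : Z → unitInterval) (l u : ℕ) (D : Fin n → Z) : Set Z :=
  φ ⁻¹' Set.Ioo (orderStat (φ ∘ D) l) (orderStat (φ ∘ D) u)

/-- The mean of `f` over the points of the sample `D` in its own band `band φ l u D`
(`0` if there are none). -/
noncomputable def bandMean (φ : Z → unitInterval) (f : Z → ℝ) (l u : ℕ) (D : Fin n → Z) : ℝ :=
  (∑ k ∈ innerIndices l u (φ ∘ D), f (D k)) / (innerIndices l u (φ ∘ D)).card

theorem measurableSet_band (hφ : Measurable φ) (D : Fin n → Z) : MeasurableSet (band φ l u D) :=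
  hφ measurableSet_Ioo

theorem measurable_orderStat_comp (hφ : Measurable φ) (i : ℕ) :
    Measurable fun D : Fin n → Z => orderStat (φ ∘ D) i :=
  (measurable_orderStat i).comp (measurable_pi_lambda _ fun k => hφ.comp (measurable_pi_apply k))

theorem measurableSet_mem_band (hφ : Measurable φ) :
    MeasurableSet {p : (Fin n → Z) × Z | p.2 ∈ band φ l u p.1} := by
  have hstat (i : ℕ) : Measurable fun p : (Fin n → Z) × Z => orderStat (φ ∘ p.1) i :=
    (measurable_orderStat_comp hφ i).comp measurable_fst
  have hscore : Measurable fun p : (Fin n → Z) × Z => φ p.2 := hφ.comp measurable_snd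
  have hlow := measurableSet_lt (hstat l) hscore
  have hupp := measurableSet_lt hscore (hstat u)
  exact hlow.inter hupp

theorem measurableSet_innerIndices_comp_eq (hφ : Measurable φ) (T : Finset (Fin n)) :
    MeasurableSet {D : Fin n → Z | innerIndices l u (φ ∘ D) = T} := by
  have hmem (k : Fin n) : MeasurableSet {D : Fin n → Z | k ∈ innerIndices l u (φ ∘ D)} := by
    simp only [mem_innerIndices]
    exact (measurable_id.prodMk (measurable_pi_apply k)) (measurableSet_mem_band hφ)
  simp only [Finset.ext_iff, Set.ofPred_forall]
  refine MeasurableSet.iInter fun k => ?_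
  by_cases hk : k ∈ T
  · simpa only [hk, iff_true] using hmem k
  · simp only [hk, iff_false]
    exact (hmem k).compl

theorem measurableSet_innerIndices_eq_and_not_isApproxMean {P : Measure Z} [SFinite P]
    (hφ : Measurable φ) (hf : Measurable f) (T : Finset (Fin n)) :
    MeasurableSet {D : Fin n → Z | innerIndices l u (φ ∘ D) = T ∧
      ¬IsApproxMean P f ε (band φ l u D) (bandMean φ f l u D)} := by
  have hmean : Measurable fun D : Fin n → Z => (∑ k ∈ T, f (D k)) / T.card :=
    (Finset.measurable_sum _ fun k _ => hf.comp (measurable_pi_apply k)).div_const _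
  have happrox := measurableSet_isApproxMean (μ := P) (ε := ε) hf
    (measurableSet_mem_band (l := l) (u := u) hφ) hmean
  have hset : {D : Fin n → Z | innerIndices l u (φ ∘ D) = T ∧
      ¬IsApproxMean P f ε (band φ l u D) (bandMean φ f l u D)} =
      {D | innerIndices l u (φ ∘ D) = T} ∩
        {D | IsApproxMean P f ε (band φ l u D) ((∑ k ∈ T, f (D k)) / T.card)}ᶜ := by
    ext D
    exact and_congr_right fun h => by subst h; rfl
  exact hset ▸ (measurableSet_innerIndices_comp_eq hφ T).inter happrox.compl

/-- Given the points outside `T`, the event that `T` indexes the points of the band says that the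
points in `T` fall into a fixed set, because moving them inside the band changes neither of the
order statistics that bound it. -/
theorem measure_pi_innerIndices_eq_and_not_isApproxMean_le (P : Measure Z) [IsFiniteMeasure P]
    (hφ : Measurable φ) (hf : Measurable f) (h01 : ∀ z, f z ∈ Set.Icc (0 : ℝ) 1) (hε : 0 ≤ ε)
    (hl : l ≤ n) (hu : 1 ≤ u) (T : Finset (Fin n)) :
    Measure.pi (fun _ => P) {D | innerIndices l u (φ ∘ D) = T ∧
        ¬IsApproxMean P f ε (band φ l u D) (bandMean φ f l u D)} ≤
      ENNReal.ofReal (2 * Real.exp (-2 * T.card * ε ^ 2)) *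
        Measure.pi (fun _ => P) {D | innerIndices l u (φ ∘ D) = T} := by
  refine measure_pi_le_mul_of_forall_updateFinset _ T (measurableSet_innerIndices_comp_eq hφ T)
    (measurableSet_innerIndices_eq_and_not_isApproxMean hφ hf T) (fun D hD => hD.1) ?_
  rintro D rfl
  set T := innerIndices l u (φ ∘ D)
  have hin (v : T → Z) (i : T) : Function.updateFinset D T v i = v i := by
    simp [Function.updateFinset]
  have hoff (v : T → Z) : ∀ k ∉ T, (φ ∘ Function.updateFinset D T v) k = (φ ∘ D) k := fun k hk => by
    simp [Function.updateFinset, hk]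
  have hbox (v : T → Z) : innerIndices l u (φ ∘ Function.updateFinset D T v) = T ↔
      ∀ i, v i ∈ band φ l u D := by
    refine (innerIndices_eq_iff_of_eqOn_compl (hoff v) hl hu).trans ?_
    refine ⟨fun h i => ?_, fun h k hk => ?_⟩
    · rw [← hin v i]
      exact h i i.2
    · rw [Function.comp_apply, hin v ⟨k, hk⟩]
      exact h ⟨k, hk⟩
  have hband (v : T → Z) (hv : innerIndices l u (φ ∘ Function.updateFinset D T v) = T) :
      band φ l u (Function.updateFinset D T v) = band φ l u D := by
    obtain ⟨hlow, hupp⟩ := orderStat_eq_of_eqOn_compl_innerIndices (hoff v) hv.ge hl hu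
    rw [band, band, hlow, hupp]
  have hmean (v : T → Z) (hv : innerIndices l u (φ ∘ Function.updateFinset D T v) = T) :
      bandMean φ f l u (Function.updateFinset D T v) = (∑ i, f (v i)) / Fintype.card T := by
    rw [bandMean, hv, Fintype.card_coe, ← Finset.sum_coe_sort T]
    simp only [hin]
  have hHoeffding := measure_pi_forall_mem_and_not_isApproxMean_le (ι := T) P hf h01
    (measurableSet_band (l := l) (u := u) hφ D) hε
  simp only [← hbox] at hHoeffding
  rw [← Fintype.card_coe T]
  refine (measure_mono fun v hv => ?_).trans hHoeffding
  obtain ⟨hinner, hdev⟩ := hv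
  rw [hband v hinner, hmean v hinner] at hdev
  exact ⟨hinner, hdev⟩

theorem measure_pi_card_innerIndices_eq_and_not_isApproxMean_le (P : Measure Z)
    [IsProbabilityMeasure P] (hφ : Measurable φ) (hf : Measurable f)
    (h01 : ∀ z, f z ∈ Set.Icc (0 : ℝ) 1) (hε : 0 ≤ ε) (hl : l ≤ n) (hu : 1 ≤ u) (N : ℕ) :
    Measure.pi (fun _ : Fin n => P) {D | (innerIndices l u (φ ∘ D)).card = N ∧
        ¬IsApproxMean P f ε (band φ l u D) (bandMean φ f l u D)} ≤
      ENNReal.ofReal (2 * Real.exp (-2 * N * ε ^ 2)) := by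
  set c := ENNReal.ofReal (2 * Real.exp (-2 * N * ε ^ 2))
  set 𝒯 : Finset (Finset (Fin n)) := {T | T.card = N} with h𝒯
  calc _ ≤ Measure.pi (fun _ => P) (⋃ T ∈ 𝒯, {D | innerIndices l u (φ ∘ D) = T ∧
          ¬IsApproxMean P f ε (band φ l u D) (bandMean φ f l u D)}) :=
        measure_mono fun D hD =>
          Set.mem_iUnion₂.2 ⟨_, (Finset.mem_filter_univ _).2 hD.1, rfl, hD.2⟩
    _ ≤ ∑ T ∈ 𝒯, Measure.pi (fun _ => P) {D | innerIndices l u (φ ∘ D) = T ∧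
          ¬IsApproxMean P f ε (band φ l u D) (bandMean φ f l u D)} :=
        measure_biUnion_finset_le _ _
    _ ≤ ∑ T ∈ 𝒯, c * Measure.pi (fun _ => P) {D | innerIndices l u (φ ∘ D) = T} := by
        refine Finset.sum_le_sum fun T hT => ?_
        rw [h𝒯, Finset.mem_filter_univ] at hT
        simpa only [hT] using
          measure_pi_innerIndices_eq_and_not_isApproxMean_le P hφ hf h01 hε hl hu T
    _ = c * Measure.pi (fun _ => P) ((fun D => innerIndices l u (φ ∘ D)) ⁻¹' 𝒯) := by
        rw [← Finset.mul_sum]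
        congr 1
        exact sum_measure_preimage_singleton 𝒯 fun T _ => measurableSet_innerIndices_comp_eq hφ T
    _ ≤ c := mul_le_of_le_one_right' prob_le_one

end Resampling

section NoTies

theorem ae_ne_of_indepFun {Ω E : Type*} [MeasurableSpace Ω] [MeasurableSpace E] [MeasurableEq E]
    {μ : Measure Ω} [IsFiniteMeasure μ] {X Y : Ω → E} (h : IndepFun X Y μ) (hX : AEMeasurable X μ)
    (hY : AEMeasurable Y μ) [NullSingletonClass (μ.map Y)] : ∀ᵐ ω ∂μ, X ω ≠ Y ω := by
  have hdiag : MeasurableSet {p : E × E | p.1 ≠ p.2} :=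
    (measurableSet_eq_fun measurable_fst measurable_snd).compl
  have hprod : ∀ᵐ p ∂(μ.map X).prod (μ.map Y), p.1 ≠ p.2 :=
    (Measure.ae_prod_iff_ae_ae hdiag).2 (ae_of_all _ fun x => by
      simpa only [ne_comm] using Measure.ae_ne (μ.map Y) x)
  rw [← h.map_prod_eq_prod_map_map hX hY] at hprod
  exact ae_of_ae_map (hX.prodMk hY) hprod

theorem ae_injective_of_iIndepFun {ι Ω E : Type*} [Countable ι] [MeasurableSpace Ω]
    [MeasurableSpace E] [MeasurableEq E] {μ : Measure Ω} [IsFiniteMeasure μ] {X : ι → Ω → E}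
    (h : iIndepFun X μ) (hX : ∀ i, AEMeasurable (X i) μ)
    [∀ i, NullSingletonClass (μ.map (X i))] :
    ∀ᵐ ω ∂μ, Function.Injective fun i => X i ω := by
  have hne : ∀ᵐ ω ∂μ, ∀ i j, i ≠ j → X i ω ≠ X j ω := by
    simp only [ae_all_iff]
    exact fun i j hij => ae_ne_of_indepFun (h.indepFun hij) (hX i) (hX j)
  filter_upwards [hne] with ω hω i j hij
  exact of_not_not fun hij' => hω i j hij' hij

theorem nullSingletonClass_map_of_map_coe_absolutelyContinuous {Z : Type*} [MeasurableSpace Z]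
    {P : Measure Z} {φ : Z → unitInterval} (hφ : Measurable φ)
    (hac : P.map (fun z => (φ z : ℝ)) ≪ volume) : NullSingletonClass (P.map φ) := by
  refine ⟨fun t => ?_⟩
  have hnull := hac (Real.volume_singleton (a := (t : ℝ)))
  have hφ' : Measurable fun z => (φ z : ℝ) := measurable_subtype_coe.comp hφ
  rw [Measure.map_apply hφ' (measurableSet_singleton _)] at hnull
  rw [Measure.map_apply hφ (measurableSet_singleton t)]
  exact measure_mono_null (fun z hz => congrArg Subtype.val hz) hnull

variable {Z : Type*} [MeasurableSpace Z] {P : Measure Z} [IsProbabilityMeasure P]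
  {φ : Z → unitInterval} [NullSingletonClass (P.map φ)] {f : Z → ℝ} {n l u : ℕ} {ε : ℝ}

theorem ae_pi_injective_comp (hφ : Measurable φ) :
    ∀ᵐ D ∂Measure.pi fun _ : Fin n => P, Function.Injective (φ ∘ D) := by
  have hlaw (k : Fin n) : (Measure.pi fun _ => P).map (fun D => φ (D k)) = P.map φ := by
    have heval := measurePreserving_eval (fun _ : Fin n => P) k
    exact (Measure.map_map hφ heval.measurable).symm.trans (congrArg _ heval.map_eq)
  have (k : Fin n) : NullSingletonClass ((Measure.pi fun _ => P).map fun D => φ (D k)) :=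
    hlaw k ▸ inferInstance
  have hind : iIndepFun (fun k D => φ (D k)) (Measure.pi fun _ : Fin n => P) :=
    iIndepFun_pi fun _ => hφ.aemeasurable
  have hinj := ae_injective_of_iIndepFun hind
    fun k => (hφ.comp (measurable_pi_apply k)).aemeasurable
  exact hinj

theorem ae_pi_comp_ne (hφ : Measurable φ) (t : unitInterval) :
    ∀ᵐ D ∂Measure.pi fun _ : Fin n => P, ∀ k, (φ ∘ D) k ≠ t :=
  ae_all_iff.2 fun k => (Measure.quasiMeasurePreserving_eval (fun _ => P) k).ae
    (ae_of_ae_map hφ.aemeasurable (Measure.ae_ne (P.map φ) t))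

theorem measure_pi_not_isApproxMean_ranksBetween_le (hφ : Measurable φ) (hf : Measurable f)
    (h01 : ∀ z, f z ∈ Set.Icc (0 : ℝ) 1) (hε : 0 ≤ ε) (hl : l ≤ n) (hu : u ∈ Set.Icc 1 (n + 1)) :
    Measure.pi (fun _ : Fin n => P) {D | ¬IsApproxMean P f ε
        (φ ⁻¹' Set.Ico (orderStat (φ ∘ D) l) (orderStat (φ ∘ D) u))
        ((∑ i ∈ ranksBetween n l u, f (D (Tuple.sort (φ ∘ D) i))) / (ranksBetween n l u).card)} ≤
      ENNReal.ofReal (2 * Real.exp (-2 * (ranksBetween n l u).card * ε ^ 2)) := by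
  refine (measure_mono_ae ?_).trans
    (measure_pi_card_innerIndices_eq_and_not_isApproxMean_le P hφ hf h01 hε hl hu.1 _)
  filter_upwards [ae_pi_injective_comp hφ, ae_pi_comp_ne hφ 0, ae_pi_comp_ne hφ 1]
    with D hinj h0 h1 hD
  have hinner := innerIndices_eq_map_sort hinj h0 h1 (Nat.le_succ_of_le hl) hu.2
  have hmean : bandMean φ f l u D =
      (∑ i ∈ ranksBetween n l u, f (D (Tuple.sort (φ ∘ D) i))) / (ranksBetween n l u).card := by
    rw [bandMean, hinner, Finset.sum_map, Finset.card_map]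
    rfl
  have hband : band φ l u D =ᵐ[P]
      φ ⁻¹' Set.Ico (orderStat (φ ∘ D) l) (orderStat (φ ∘ D) u) :=
    (hφ.quasiMeasurePreserving P).preimage_ae_eq Ioo_ae_eq_Ico
  refine ⟨by rw [hinner, Finset.card_map], ?_⟩
  rw [hmean, isApproxMean_congr_set hband]
  exact hD

end NoTies

section CondExpOnBins

variable {Z : Type*} {mZ : MeasurableSpace Z} {μ : Measure Z} {f : Z → ℝ} {ε : ℝ}

theorem ae_abs_condExp_le_of_abs_setIntegral_le [IsFiniteMeasure μ] {m : MeasurableSpace Z}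
    (hm : m ≤ mZ) (hf : Integrable f μ)
    (h : ∀ S, MeasurableSet[m] S → |∫ z in S, f z ∂μ| ≤ ε * μ.real S) :
    ∀ᵐ z ∂μ, |(μ[f | m]) z| ≤ ε := by
  have hcond : Integrable (μ[f | m]) (μ.trim hm) :=
    integrable_condExp.trim hm stronglyMeasurable_condExp
  have hset (S : Set Z) (hS : MeasurableSet[m] S) :
      |∫ z in S, (μ[f | m]) z ∂μ.trim hm| ≤ ε * (μ.trim hm).real S := by
    rw [← setIntegral_trim hm stronglyMeasurable_condExp hS, setIntegral_condExp hm hf hS,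
      measureReal_def, trim_measurableSet_eq hm hS]
    exact h S hS
  have hupp : μ[f | m] ≤ᵐ[μ.trim hm] fun _ => ε := by
    refine ae_le_of_forall_setIntegral_le hcond (integrable_const _) fun S hS _ => ?_
    rw [setIntegral_const, smul_eq_mul, mul_comm]
    exact (abs_le.1 (hset S hS)).2
  have hlow : (fun _ => -ε) ≤ᵐ[μ.trim hm] μ[f | m] := by
    refine ae_le_of_forall_setIntegral_le (integrable_const _) hcond fun S hS _ => ?_
    rw [setIntegral_const, smul_eq_mul, mul_neg, mul_comm]
    exact (abs_le.1 (hset S hS)).1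
  filter_upwards [ae_of_ae_trim hm hlow, ae_of_ae_trim hm hupp] with z h₁ h₂ using
    abs_le.2 ⟨h₁, h₂⟩

variable {ι : Type*} {s : Finset ι} {A : ι → Set Z}

theorem abs_setIntegral_le_of_forall_inter [IsFiniteMeasure μ] (hf : Integrable f μ)
    (hA : ∀ i, MeasurableSet (A i)) (hdisj : (s : Set ι).PairwiseDisjoint A)
    (hcover : ∀ᵐ z ∂μ, ∃ i ∈ s, z ∈ A i) {S : Set Z} (hS : MeasurableSet S)
    (h : ∀ i ∈ s, |∫ z in S ∩ A i, f z ∂μ| ≤ ε * μ.real (S ∩ A i)) :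
    |∫ z in S, f z ∂μ| ≤ ε * μ.real S := by
  have hSA : S =ᵐ[μ] (⋃ i ∈ s, S ∩ A i : Set Z) := by
    refine Filter.eventuallyEq_set.2 ?_
    filter_upwards [hcover] with z hz
    simp only [Set.mem_iUnion, Set.mem_inter_iff, exists_prop]
    exact ⟨fun hzS => hz.imp fun i hi => ⟨hi.1, hzS, hi.2⟩, fun ⟨_, _, hzS, _⟩ => hzS⟩
  have hdisjS : (s : Set ι).PairwiseDisjoint fun i => S ∩ A i :=
    hdisj.mono fun _ => Set.inter_subset_right
  rw [setIntegral_congr_set hSA, measureReal_congr hSA,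
    integral_biUnion_finset _ (fun i _ => hS.inter (hA i)) hdisjS fun i _ => hf.integrableOn,
    measureReal_biUnion_finset hdisjS fun i _ => hS.inter (hA i), Finset.mul_sum]
  exact (Finset.abs_sum_le_sum_abs _ _).trans (Finset.sum_le_sum h)

theorem ae_abs_condExp_comap_sub_le_of_isApproxMean [IsFiniteMeasure μ] {E : Type*}
    [mE : MeasurableSpace E] {H : Z → E} {κ : E → ℝ} {e : ι → E} (hf : Integrable f μ)
    (hH : Measurable H) (hκ : Measurable κ) (hκH : Integrable (κ ∘ H) μ)
    (hA : ∀ i, MeasurableSet (A i)) (hdisj : (s : Set ι).PairwiseDisjoint A)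
    (hcover : ∀ᵐ z ∂μ, ∃ i ∈ s, z ∈ A i) (hconst : ∀ i ∈ s, ∀ z ∈ A i, H z = e i)
    (happrox : ∀ i ∈ s, IsApproxMean μ f ε (A i) (κ (e i))) :
    ∀ᵐ z ∂μ, |(μ[f | mE.comap H]) z - κ (H z)| ≤ ε := by
  have hκHm : StronglyMeasurable[mE.comap H] (κ ∘ H) :=
    (hκ.comp (comap_measurable H)).stronglyMeasurable
  have hsub : μ[f - κ ∘ H | mE.comap H] =ᵐ[μ] μ[f | mE.comap H] - κ ∘ H := by
    simpa only [condExp_of_stronglyMeasurable hH.comap_le hκHm hκH] using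
      condExp_sub hf hκH (mE.comap H)
  have hbound : ∀ᵐ z ∂μ, |(μ[f - κ ∘ H | mE.comap H]) z| ≤ ε := by
    refine ae_abs_condExp_le_of_abs_setIntegral_le hH.comap_le (hf.sub hκH) ?_
    rintro _ ⟨R, hR, rfl⟩
    refine abs_setIntegral_le_of_forall_inter (hf.sub hκH) hA hdisj hcover (hH hR) fun i hi => ?_
    by_cases hiR : e i ∈ R
    · have hsubset : A i ⊆ H ⁻¹' R := fun z hz => by rwa [Set.mem_preimage, hconst i hi z hz]
      have hcongr : Set.EqOn (f - κ ∘ H) (fun z => f z - κ (e i)) (A i) := fun z hz => by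
        simp only [Pi.sub_apply, Function.comp_apply, hconst i hi z hz]
      rw [Set.inter_eq_right.2 hsubset, setIntegral_congr_fun (hA i) hcongr]
      exact happrox i hi
    · have hempty : H ⁻¹' R ∩ A i = ∅ := Set.eq_empty_of_forall_notMem fun z hz =>
        hiR (hconst i hi z hz.2 ▸ hz.1)
      simp [hempty]
  filter_upwards [hsub, hbound] with z hz hle
  rwa [hz] at hle

end CondExpOnBins

section CalibrationError

variable {𝒳 : Type*} [MeasurableSpace 𝒳] {P : Measure (𝒳 × unitInterval)} {h : Predictor 𝒳}
  {ε : ℝ}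

theorem isCalibratedPredictor_of_ae (hε : 0 ≤ ε)
    (hae : ∀ᵐ z ∂P, |condLabel P h z - (h.1 z.1 : ℝ)| ≤ ε) : IsCalibratedPredictor P h ε := by
  obtain ⟨m, hm, heq⟩ := (stronglyMeasurable_condExp (μ := P) (f := fun z => (z.2 : ℝ))
    (m := MeasurableSpace.comap (fun z : 𝒳 × unitInterval => h.1 z.1)
      inferInstance)).measurable.exists_eq_measurable_comp
  have hcoe : Measurable fun r : unitInterval => (r : ℝ) := measurable_subtype_coe
  have hle (r : unitInterval) : (r : ℝ) - ε ≤ r + ε := by linarith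
  -- A version of the regression function may violate the bound on a null set, so it is clamped.
  refine ⟨fun r => max (r - ε) (min (r + ε) (m r)), ⟨?_, ?_⟩, fun r _ => ?_⟩
  · exact (hcoe.sub_const ε).max ((hcoe.add_const ε).min hm)
  · filter_upwards [hae] with z hz
    rw [abs_sub_le_iff, condLabel, heq, Function.comp_apply] at hz
    rw [condLabel, heq, Function.comp_apply, min_eq_right (by linarith), max_eq_right (by linarith)]
  · rw [abs_sub_le_iff, sub_le_iff_le_add', sub_le_comm]
    exact ⟨max_le (hle r) (min_le_left _ _), le_max_left _ _⟩

theorem ece_le_of_ae [IsProbabilityMeasure P]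
    (hae : ∀ᵐ z ∂P, |condLabel P h z - (h.1 z.1 : ℝ)| ≤ ε) {p : ℝ} (hp : 0 < p) :
    ece P p h ≤ ENNReal.ofReal ε := by
  rw [ece, one_div, ENNReal.rpow_inv_le_iff hp]
  refine (lintegral_mono_ae ?_).trans_eq (by rw [lintegral_const, measure_univ, mul_one])
  filter_upwards [hae] with z hz
  rw [← ENNReal.ofReal_rpow_of_nonneg (abs_nonneg _) hp.le]
  gcongr

end CalibrationError

section HighProbability

theorem exp_neg_two_mul_sqrt_log_div_sq {K x : ℝ} (hK : 0 < K) (hx : 1 ≤ x) :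
    Real.exp (-2 * K * Real.sqrt (Real.log x / (2 * K)) ^ 2) = x⁻¹ := by
  have hlog := Real.log_nonneg hx
  have hexp : -2 * K * (Real.log x / (2 * K)) = -Real.log x := by field
  rw [Real.sq_sqrt (by positivity), hexp, Real.exp_neg, Real.exp_log (by positivity)]

theorem withProbAtLeast_of_measure_not_le {Ω : Type*} [MeasurableSpace Ω] {μ : Measure Ω}
    [IsProbabilityMeasure μ] {Q R : Ω → Prop} {α : ℝ} (hα : 0 ≤ α)
    (hQ : μ {ω | ¬Q ω} ≤ ENNReal.ofReal α) (hQR : ∀ ω, Q ω → R ω) :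
    WithProbAtLeast μ (1 - α) R := by
  have hmeas := measurableSet_toMeasurable μ {ω | ¬Q ω}
  refine ⟨(toMeasurable μ {ω | ¬Q ω})ᶜ, hmeas.compl, ?_, fun ω hω =>
    hQR ω (of_not_not fun hne => hω (subset_toMeasurable μ _ hne))⟩
  rw [prob_compl_eq_one_sub hmeas, measure_toMeasurable, ENNReal.ofReal_sub _ hα,
    ENNReal.ofReal_one]
  gcongr

end HighProbability

section Cuts

theorem cut_zero (n B : ℕ) : cut n B 0 = 0 := by
  simp [cut]

theorem cut_self (n : ℕ) {B : ℕ} (hB : 1 ≤ B) : cut n B B = n + 1 := by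
  have hB0 : (B : ℝ) ≠ 0 := by positivity
  rw [cut, mul_div_cancel₀ _ hB0]
  exact_mod_cast Nat.ceil_natCast (R := ℝ) (n + 1)

theorem cut_add_le_cut_succ (n B b : ℕ) : cut n B b + n / B ≤ cut n B (b + 1) := by
  rw [cut, cut, ← Nat.ceil_add_natCast (by positivity)]
  refine Nat.ceil_mono ?_
  have hstep : ((n / B : ℕ) : ℝ) ≤ ((n : ℝ) + 1) / B :=
    Nat.cast_div_le.trans (div_le_div_of_nonneg_right (le_add_of_nonneg_right zero_le_one)
      (Nat.cast_nonneg B))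
  push_cast
  rw [add_one_mul]
  gcongr

theorem cut_le {n B b : ℕ} (hB : 1 ≤ B) (hb : b ≤ B) : cut n B b ≤ n + 1 :=
  cut_self n hB ▸ cut_mono n B hb

end Cuts

section Binning

variable {n B : ℕ}

/-- The scores of the `b`-th bin, which contains its left end point as in `binnedValue`. -/
def binInterval (B : ℕ) (s : Fin n → unitInterval) (b : ℕ) : Set unitInterval :=
  Set.Ico (orderStat s (cut n B b)) (orderStat s (cut n B (b + 1)))

theorem pairwise_disjoint_binInterval (B : ℕ) (s : Fin n → unitInterval) :
    Pairwise (Function.onFun Disjoint (binInterval B s)) :=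
  ((orderStat_mono s).comp (cut_mono n B)).pairwise_disjoint_on_Ico_succ

theorem exists_mem_binInterval (hB : 1 ≤ B) (s : Fin n → unitInterval) {t : unitInterval}
    (ht : t ≠ 1) : ∃ b ∈ Finset.range B, t ∈ binInterval B s b := by
  have hmem : t ∈ Set.Ico (orderStat s (cut n B 0)) (orderStat s (cut n B B)) := by
    rw [cut_zero, orderStat_zero, cut_self n hB, orderStat_of_lt s n.lt_succ_self]
    exact ⟨unitInterval.nonneg', unitInterval.lt_one_iff_ne_one.2 ht⟩
  obtain ⟨b, hb, htb⟩ :=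
    Set.mem_iUnion₂.1 (Ico_subset_biUnion_Ico B (fun b => orderStat s (cut n B b)) hmem)
  exact ⟨b, hb, htb⟩

theorem binnedValue_eq_binMean (s y : Fin n → unitInterval) {t : unitInterval} {b : ℕ}
    (hb : b ∈ Finset.range B) (ht : t ∈ binInterval B s b) :
    binnedValue B s y t = binMean B s y b := by
  have hne : ∀ c ∈ Finset.range B, c ≠ b → t ∉ binInterval B s c := fun c _ hcb hc =>
    Set.disjoint_left.1 (pairwise_disjoint_binInterval B s hcb) hc ht
  exact (Finset.sum_eq_single_of_mem b hb fun c hc hcb => if_neg (hne c hc hcb)).trans (if_pos ht)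

variable {𝒳 : Type*} [MeasurableSpace 𝒳] {P : Measure (𝒳 × unitInterval)} {g : Predictor 𝒳} {ε : ℝ}

/-- Every bin mean computed from the data `D` is within `ε` of the mean label of the bin; on this
event the binned predictor is calibrated. -/
def BinMeansApprox (P : Measure (𝒳 × unitInterval)) (g : Predictor 𝒳) (B : ℕ) (ε : ℝ)
    (D : Fin n → 𝒳 × unitInterval) : Prop :=
  ∀ b ∈ Finset.range B, IsApproxMean P (fun z => (z.2 : ℝ)) ε
    ((fun z => g.1 z.1) ⁻¹' binInterval B (fun i => g.1 (D i).1) b)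
    (binMean B (fun i => g.1 (D i).1) (fun i => (D i).2) b)

variable [IsProbabilityMeasure P] [NullSingletonClass (P.map fun z => g.1 z.1)]

theorem dataLaw_not_isApproxMean_binMean_le (hB : 1 ≤ B) (hn : B ≤ n) (hε : 0 ≤ ε) {b : ℕ}
    (hb : b ∈ Finset.range B) :
    dataLaw P n {D | ¬IsApproxMean P (fun z => (z.2 : ℝ)) ε
        ((fun z => g.1 z.1) ⁻¹' binInterval B (fun i => g.1 (D i).1) b)
        (binMean B (fun i => g.1 (D i).1) (fun i => (D i).2) b)} ≤
      ENNReal.ofReal (2 * Real.exp (-2 * ((n / B : ℕ) - 1) * ε ^ 2)) := by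
  have hsize : 1 ≤ n / B := Nat.div_pos hn hB
  have hgap := cut_add_le_cut_succ n B b
  have hle : cut n B (b + 1) ≤ n + 1 := cut_le hB (Finset.mem_range.1 hb)
  have hscore : Measurable fun z : 𝒳 × unitInterval => g.1 z.1 := g.2.comp measurable_fst
  have hlabel : Measurable fun z : 𝒳 × unitInterval => (z.2 : ℝ) :=
    measurable_subtype_coe.comp measurable_snd
  have hcard : ((n / B : ℕ) : ℝ) - 1 ≤ (ranksBetween n (cut n B b) (cut n B (b + 1))).card := by
    rw [sub_le_iff_le_add, card_ranksBetween hle]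
    norm_cast
    omega
  refine (measure_pi_not_isApproxMean_ranksBetween_le hscore hlabel (fun z => z.2.2) hε
    (by omega) ⟨by omega, hle⟩).trans (ENNReal.ofReal_le_ofReal ?_)
  simp only [neg_mul]
  gcongr

theorem dataLaw_not_binMeansApprox_le (hB : 1 ≤ B) (hn : B ≤ n) (hε : 0 ≤ ε) :
    dataLaw P n {D | ¬BinMeansApprox P g B ε D} ≤
      ENNReal.ofReal (2 * B * Real.exp (-2 * ((n / B : ℕ) - 1) * ε ^ 2)) := by
  calc dataLaw P n {D | ¬BinMeansApprox P g B ε D}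
    _ ≤ dataLaw P n (⋃ b ∈ Finset.range B, {D | ¬IsApproxMean P (fun z => (z.2 : ℝ)) ε
          ((fun z => g.1 z.1) ⁻¹' binInterval B (fun i => g.1 (D i).1) b)
          (binMean B (fun i => g.1 (D i).1) (fun i => (D i).2) b)}) := measure_mono fun D hD => by
        simpa [BinMeansApprox] using hD
    _ ≤ ∑ _b ∈ Finset.range B, ENNReal.ofReal (2 * Real.exp (-2 * ((n / B : ℕ) - 1) * ε ^ 2)) :=
        (measure_biUnion_finset_le _ _).trans (Finset.sum_le_sum fun b hb =>
          dataLaw_not_isApproxMean_binMean_le hB hn hε hb)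
    _ = ENNReal.ofReal (2 * B * Real.exp (-2 * ((n / B : ℕ) - 1) * ε ^ 2)) := by
        rw [Finset.sum_const, Finset.card_range, ← ENNReal.ofReal_nsmul, nsmul_eq_mul,
          mul_left_comm, ← mul_assoc]

theorem ae_abs_condLabel_umd_sub_le (hB : 1 ≤ B) {D : Fin n → 𝒳 × unitInterval}
    (hD : BinMeansApprox P g B ε D) :
    ∀ᵐ z ∂P, |condLabel P (umd n B g D) z - ((umd n B g D).1 z.1 : ℝ)| ≤ ε := by
  have hscore : Measurable fun z : 𝒳 × unitInterval => g.1 z.1 := g.2.comp measurable_fst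
  have hvalue : Measurable fun z : 𝒳 × unitInterval => (umd n B g D).1 z.1 :=
    (umd n B g D).2.comp measurable_fst
  have hcoe : Measurable fun r : unitInterval => (r : ℝ) := measurable_subtype_coe
  set s : Fin n → unitInterval := fun i => g.1 (D i).1
  set y : Fin n → unitInterval := fun i => (D i).2
  refine ae_abs_condExp_comap_sub_le_of_isApproxMean (s := Finset.range B)
    (A := fun b => (fun z : 𝒳 × unitInterval => g.1 z.1) ⁻¹' binInterval B s b)
    (e := fun b => ⟨binMean B s y b, binMean_mem B s y b⟩)
    (.of_mem_Icc 0 1 (hcoe.comp measurable_snd).aemeasurable (ae_of_all _ fun z => z.2.2)) hvalue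
    hcoe (.of_mem_Icc 0 1 (hcoe.comp hvalue).aemeasurable (ae_of_all _ fun z => Subtype.prop _))
    (fun b => hscore measurableSet_Ico) ?_ ?_ ?_ hD
  · exact fun b _ c _ hbc => (pairwise_disjoint_binInterval B s hbc).preimage _
  · filter_upwards [ae_of_ae_map hscore.aemeasurable (Measure.ae_ne _ 1)] with z hz
    exact exists_mem_binInterval hB s hz
  · exact fun b hb z hz => Subtype.ext (binnedValue_eq_binMean s y hb hz)

end Binning

end UMD

theorem theorem1_general {𝒳 : Type*} [MeasurableSpace 𝒳] (n B : ℕ) (hB : 1 ≤ B) (hn : 2 * B ≤ n)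
    (g : UMD.Predictor 𝒳) (P : Measure (𝒳 × unitInterval)) [IsProbabilityMeasure P]
    [NullSingletonClass (P.map fun z => g.1 z.1)]
    (α : ℝ) (hα₀ : 0 < α) (hα₁ : α < 1)
    (ε : ℝ) (hε : ε = Real.sqrt (Real.log (2 * (B : ℝ) / α) / (2 * (((n / B : ℕ) : ℝ) - 1)))) :
    UMD.ConditionallyCalibratedAt (UMD.umd n B) g P ε α ∧
    UMD.WithProbAtLeast (UMD.dataLaw P n) (1 - α) fun D =>
      ∀ p : ℝ, 1 ≤ p → UMD.ece P p (UMD.umd n B g D) ≤ ENNReal.ofReal ε := by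
  have hε₀ : 0 ≤ ε := hε ▸ Real.sqrt_nonneg _
  have : IsProbabilityMeasure (UMD.dataLaw P n) := Measure.pi.instIsProbabilityMeasure _
  have hB' : (1 : ℝ) ≤ B := by exact_mod_cast hB
  have hsize : (2 : ℝ) ≤ (n / B : ℕ) := by exact_mod_cast (Nat.le_div_iff_mul_le hB).2 hn
  have hratio : 1 ≤ 2 * (B : ℝ) / α := (one_le_div hα₀).2 (by linarith)
  have hbins := UMD.dataLaw_not_binMeansApprox_le (P := P) (g := g) hB (by omega : B ≤ n) hε₀
  rw [hε, UMD.exp_neg_two_mul_sqrt_log_div_sq (by linarith) hratio, inv_div,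
    mul_div_cancel₀ _ (by positivity), ← hε] at hbins
  exact ⟨UMD.withProbAtLeast_of_measure_not_le hα₀.le hbins fun D hD =>
      UMD.isCalibratedPredictor_of_ae hε₀ (UMD.ae_abs_condLabel_umd_sub_le hB hD),
    UMD.withProbAtLeast_of_measure_not_le hα₀.le hbins fun D hD p hp =>
      UMD.ece_le_of_ae (UMD.ae_abs_condLabel_umd_sub_le hB hD) (by linarith)⟩

theorem theorem1 {𝒳 : Type*} [MeasurableSpace 𝒳] (n B : ℕ) (hB : 1 ≤ B) (hn : 2 * B ≤ n)
    (g : UMD.Predictor 𝒳) (P : Measure (𝒳 × unitInterval)) [IsProbabilityMeasure P]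
    (hac : P.map (fun z => (g.1 z.1 : ℝ)) ≪ volume)
    (α : ℝ) (hα₀ : 0 < α) (hα₁ : α < 1)
    (ε : ℝ) (hε : ε = Real.sqrt (Real.log (2 * (B : ℝ) / α) / (2 * (((n / B : ℕ) : ℝ) - 1)))) :
    UMD.ConditionallyCalibratedAt (UMD.umd n B) g P ε α ∧
    UMD.WithProbAtLeast (UMD.dataLaw P n) (1 - α) fun D =>
      ∀ p : ℝ, 1 ≤ p → UMD.ece P p (UMD.umd n B g D) ≤ ENNReal.ofReal ε := by
  have : NullSingletonClass (P.map fun z => g.1 z.1) :=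
    UMD.nullSingletonClass_map_of_map_coe_absolutelyContinuous (g.2.comp measurable_fst) hac
  exact theorem1_general n B hB hn g P α hα₀ hα₁ ε hε
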